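/- Let $d,b,m,n$ be natural numbers with $n\ge 1$, let $\psi\colon\mathbb R^d\to\mathbb R^b$ be a fixed measurable feature map, and let $a\in\mathbb R^m$ be a fixed attribute vector. For a matrix $W\in\mathbb R^{m\times b}$ the bilinear linear-in-attribute model is $g(x,a)=a^\top W\psi(x)=\tilde w^\top\tilde x$, where $\tilde w=\mathrm{vec}(W^\top)\in\mathbb R^{mb}$ and $\tilde x=\mathrm{vec}(\psi(x)a^\top)\in\mathbb R^{mb}$. For $B_w>0$ let $$\mathcal H=\{\,h\colon\mathbb R^{mb}\to\mathbb R \;:\; h(\tilde x)=\tilde w^\top\tilde x,\ \tilde w=\mathrm{vec}(W^\top),\ W\in\mathbb R^{m\times b},\ \|\tilde w\|_2\le B_w\,\}.$$ Let $x$ be a random vector in $\mathbb R^d$ with an arbitrary law, let $Q$ be the law of $\tilde x=\mathrm{vec}(\psi(x)a^\top)$, and let $\tilde x_1,\dots,\tilde x_n$ be drawn independently from $Q$. Let $f_Q\colon\mathbb R^{mb}\to\mathbb R$ be a measurable labeling function, so that the labels are $y_i=f_Q(\tilde x_i)$. Let $q\ge 1$ be real, $\ell_q(y,y')=|y-y'|^q$,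 and $$J_Q(h)=\mathbb E_{\tilde x\sim Q}\big[\ell_q(h(\tilde x),f_Q(\tilde x))\big],\qquad \widehat J_Q(h)=\frac1n\sum_{i=1}^n\ell_q(h(\tilde x_i),f_Q(\tilde x_i)).$$ Assume that $\|\psi(x)\|_2\le B_x$ almost surely, that $\|a\|_2\le B_a$, and that there is $M>0$ such that for $Q$-almost every $\tilde x$, $|h(\tilde x)-f_Q(\tilde x)|\le M$ for all $h\in\mathcal H$. Then for every $\delta>0$, with probability at least $1-\delta$ over the sample, the following holds simultaneously for all $h\in\mathcal H$: $$J_Q(h)\;\le\;\widehat J_Q(h)+\frac{2qM^{q-1}B}{\sqrt n}+M^q\sqrt{\frac{\ln(1/\delta)}{2n}},\qquad B=B_wB_xB_a.$$ (For $\delta>1$ the claim is void, since $1-\delta<0$.) -/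

import Mathlib

open MeasureTheory
open scoped Matrix RealInnerProductSpace

noncomputable section

/-- The bilinear linear-in-attribute model `g(x, a) = aᵀ W ψ(x)`. -/
def bilinearLAM {d b m : ℕ} (ψ : EuclideanSpace ℝ (Fin d) → EuclideanSpace ℝ (Fin b))
    (W : Matrix (Fin m) (Fin b) ℝ) (x : EuclideanSpace ℝ (Fin d))
    (a : EuclideanSpace ℝ (Fin m)) : ℝ :=
  a.ofLp ⬝ᵥ (W *ᵥ (ψ x).ofLp)

/-- The vectorized weight `vec(Wᵀ)`, a Euclidean vector; its `(i, j)` coordinate is `W i j`. -/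
def weightVec {b m : ℕ} (W : Matrix (Fin m) (Fin b) ℝ) :
    EuclideanSpace ℝ (Fin m × Fin b) :=
  WithLp.toLp 2 Wᵀ.vec

/-- The vectorized input `vec(ψ(x) aᵀ)`, a Euclidean vector;
its `(i, j)` coordinate is `ψ(x)ⱼ aᵢ`. -/
def liftedInput {d b m : ℕ} (ψ : EuclideanSpace ℝ (Fin d) → EuclideanSpace ℝ (Fin b))
    (a : EuclideanSpace ℝ (Fin m)) (x : EuclideanSpace ℝ (Fin d)) :
    EuclideanSpace ℝ (Fin m × Fin b) :=
  WithLp.toLp 2 (Matrix.vecMulVec (ψ x).ofLp a.ofLp).vec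

/-- The bilinear model is the linear function `w̃ᵀ x̃` of the vectorized input. -/
theorem bilinearLAM_eq_inner {d b m : ℕ}
    (ψ : EuclideanSpace ℝ (Fin d) → EuclideanSpace ℝ (Fin b))
    (W : Matrix (Fin m) (Fin b) ℝ) (x : EuclideanSpace ℝ (Fin d))
    (a : EuclideanSpace ℝ (Fin m)) :
    bilinearLAM ψ W x a = ⟪weightVec W, liftedInput ψ a x⟫ := by
  simp only [bilinearLAM, weightVec, liftedInput, PiLp.inner_apply, Fintype.sum_prod_type,
    dotProduct, Matrix.mulVec, Matrix.vec, Matrix.vecMulVec_apply, Matrix.transpose_apply,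
    Finset.mul_sum, RCLike.inner_apply, conj_trivial]
  refine Finset.sum_congr rfl fun i _ => Finset.sum_congr rfl fun j _ => ?_
  ring

/-- The class `H` of linear functions `h(x̃) = w̃ᵀ x̃` with `w̃ = vec(Wᵀ)` and `‖w̃‖₂ ≤ Bw`. -/
def lamClass (m b : ℕ) (Bw : ℝ) : Set (EuclideanSpace ℝ (Fin m × Fin b) → ℝ) :=
  {h | ∃ W : Matrix (Fin m) (Fin b) ℝ, ‖weightVec W‖ ≤ Bw ∧ ∀ z, h z = ⟪weightVec W, z⟫}

/-- The distribution `Q` of `x̃ = vec(ψ(x) aᵀ)` when `x` has law `μ` and `a` is fixed. -/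
def sourceLaw {d b m : ℕ} (μ : Measure (EuclideanSpace ℝ (Fin d)))
    (ψ : EuclideanSpace ℝ (Fin d) → EuclideanSpace ℝ (Fin b))
    (a : EuclideanSpace ℝ (Fin m)) : Measure (EuclideanSpace ℝ (Fin m × Fin b)) :=
  μ.map (liftedInput ψ a)

/-- The loss `ℓ_q(y, y') = |y - y'|^q`. -/
def lqLoss (q : ℝ) (y y' : ℝ) : ℝ := |y - y'| ^ q

/-- The expected risk `J_Q(h) = E_Q[ℓ(h(x̃), f(x̃))]`. -/
def expectedRisk {Z : Type*} [MeasurableSpace Z] (ℓ : ℝ → ℝ → ℝ) (Q : Measure Z)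
    (f h : Z → ℝ) : ℝ :=
  ∫ z, ℓ (h z) (f z) ∂Q

/-- The empirical risk `(1/n) ∑ᵢ ℓ(h(x̃ᵢ), f(x̃ᵢ))` on the sample `S = (x̃₁, …, x̃ₙ)`. -/
def empiricalRisk {Z : Type*} {n : ℕ} (ℓ : ℝ → ℝ → ℝ) (S : Fin n → Z) (f h : Z → ℝ) : ℝ :=
  (1 / (n : ℝ)) * ∑ i, ℓ (h (S i)) (f (S i))

end

/-! The largest gap between risk and empirical risk over the class concentrates around its mean, and
that mean is a Rademacher average. `measure_real_ge_le_of_bounded_differences` (McDiarmid) gives the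
`√(ln(1/δ)/2n)` term. Symmetrization (`integral_ciSup_le_of_rademacher`) bounds the mean by twice
the Rademacher complexity of the losses. Contraction (`sum_ciSup_boolSign_le_of_contraction`) trades
the loss for its Lipschitz constant `q M^(q-1)`, leaving linear functionals on a ball, whose
complexity is `Bw Bx Ba / √n` since `‖x̃‖ = ‖ψ(x)‖ ‖a‖`.

Two devices make this rigorous. Residuals are bounded by `M` only almost surely, so the loss is
truncated at `M`: it is then bounded and Lipschitz everywhere, and unchanged almost surely. Suprema
run over a dense sequence of weights, hence are measurable; continuity in the weight recovers the
whole ball. -/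

/-! ### Concentration: Hoeffding's lemma and McDiarmid's inequality. -/

section BoundedDifferences

variable {Z : Type*} [MeasurableSpace Z]

theorem integrable_of_abs_le {ν : Measure Z} [IsFiniteMeasure ν] {f : Z → ℝ}
    (hf : Measurable f) {C : ℝ} (hC : ∀ z, |f z| ≤ C) : Integrable f ν :=
  Integrable.of_bound hf.aestronglyMeasurable C (ae_of_all _ hC)

theorem abs_integral_le_of_abs_le {ν : Measure Z} [IsProbabilityMeasure ν] {f : Z → ℝ}
    {C : ℝ} (hC : ∀ z, |f z| ≤ C) : |∫ z, f z ∂ν| ≤ C := by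
  simpa using norm_integral_le_of_norm_le_const (μ := ν) (f := f) (ae_of_all _ hC)

/-- Splitting off the first coordinate of an integral over a finite power of a measure. -/
theorem integral_pi_succ (ν : Measure Z) [IsProbabilityMeasure ν] {n : ℕ}
    (F : (Fin (n + 1) → Z) → ℝ) (hF : Measurable F) {C : ℝ} (hC : ∀ S, |F S| ≤ C) :
    ∫ S, F S ∂(Measure.pi fun _ : Fin (n + 1) => ν) =
      ∫ S, ∫ z, F (Fin.cons z S) ∂ν ∂(Measure.pi fun _ : Fin n => ν) := by
  have he := (measurePreserving_piFinSuccAbove (fun _ : Fin (n + 1) => ν) 0).symm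
  rw [← he.integral_comp']
  have hcons : ∀ p : Z × (Fin n → Z),
      (MeasurableEquiv.piFinSuccAbove (fun _ : Fin (n + 1) => Z) 0).symm p = Fin.cons p.1 p.2 := by
    intro p
    simp [MeasurableEquiv.piFinSuccAbove, Fin.insertNthEquiv]
  have hmeas := hF.comp (MeasurableEquiv.piFinSuccAbove (fun _ : Fin (n + 1) => Z) 0).symm.measurable
  rw [integral_prod_symm]
  · simp only [hcons]
  · exact integrable_of_abs_le hmeas fun p => hC _

theorem measurable_fin_cons {n : ℕ} :
    Measurable fun p : Z × (Fin n → Z) => (Fin.cons p.1 p.2 : Fin (n + 1) → Z) := by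
  refine measurable_pi_iff.2 fun i => ?_
  refine Fin.cases ?_ (fun j => ?_) i
  · simpa using measurable_fst
  · simpa [Function.comp_def] using (measurable_pi_apply j).comp (measurable_snd (α := Z))

/-- A function whose oscillation is at most `c` satisfies Hoeffding's bound on its centered
moment generating function. -/
theorem integral_exp_centered_le_of_oscillation (ν : Measure Z) [IsProbabilityMeasure ν]
    {f : Z → ℝ} (hf : Measurable f) {c : ℝ} (hc : ∀ z w, f z - f w ≤ c) (s : ℝ) :
    ∫ z, Real.exp (s * (f z - ∫ w, f w ∂ν)) ∂ν ≤ Real.exp ((c / 2) ^ 2 * s ^ 2 / 2) := by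
  have hne : Nonempty Z := ν.nonempty_of_neZero
  obtain ⟨w₀⟩ := hne
  have hbdd : BddBelow (Set.range f) := ⟨f w₀ - c, by rintro _ ⟨z, rfl⟩; linarith [hc w₀ z]⟩
  -- An oscillation bound places `f` in an interval of length `c` starting at its infimum, as
  -- Hoeffding's lemma requires.
  have hIcc : ∀ z, f z ∈ Set.Icc (⨅ w, f w) ((⨅ w, f w) + c) := fun z => by
    refine ⟨ciInf_le hbdd z, ?_⟩
    have : f z - c ≤ ⨅ w, f w := by
      have : Nonempty Z := ⟨w₀⟩
      exact le_ciInf fun w => by linarith [hc z w]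
    linarith
  have h := (ProbabilityTheory.hasSubgaussianMGF_of_mem_Icc (μ := ν) hf.aemeasurable
    (ae_of_all _ hIcc)).mgf_le s
  simpa [ProbabilityTheory.mgf, div_pow] using h

/-- The moment generating function bound behind McDiarmid's inequality. -/
theorem integral_exp_centered_le_of_bounded_differences (ν : Measure Z) [IsProbabilityMeasure ν]
    {c : ℝ} (s : ℝ) : ∀ (n : ℕ) (F : (Fin n → Z) → ℝ), Measurable F → ∀ C, (∀ S, |F S| ≤ C) →
      (∀ S i z, F (Function.update S i z) - F S ≤ c) →
      ∫ S, Real.exp (s * (F S - ∫ T, F T ∂(Measure.pi fun _ => ν))) ∂(Measure.pi fun _ => ν) ≤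
        Real.exp (n * (c / 2) ^ 2 * s ^ 2 / 2)
  | 0, F, _, _, _, _ => by
    simp [Measure.pi_of_empty (fun _ : Fin 0 => ν) (fun i => i.elim0)]
  | n + 1, F, hF, C, hC, hd => by
    -- Averaging out the first coordinate keeps both the mean and the bounded differences, so the
    -- induction hypothesis applies to `G`.
    set G : (Fin n → Z) → ℝ := fun S => ∫ z, F (Fin.cons z S) ∂ν with hG
    have hFc : Measurable fun p : Z × (Fin n → Z) => F (Fin.cons p.1 p.2) :=
      hF.comp measurable_fin_cons
    have hFz : ∀ S : Fin n → Z, Measurable fun z => F (Fin.cons z S : Fin (n + 1) → Z) :=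
      fun S => hFc.comp (measurable_id.prodMk measurable_const)
    have hGm : Measurable G :=
      (StronglyMeasurable.integral_prod_right' (ν := ν)
        (hFc.comp measurable_swap).stronglyMeasurable).measurable
    have hGC : ∀ S, |G S| ≤ C := fun S => abs_integral_le_of_abs_le fun z => hC _
    have hGd : ∀ S i z, G (Function.update S i z) - G S ≤ c := by
      intro S i z
      rw [hG, ← integral_sub (integrable_of_abs_le (hFz _) fun _ => hC _)
        (integrable_of_abs_le (hFz _) fun _ => hC _)]
      calc _ ≤ ∫ _, c ∂ν := by
            refine integral_mono ((integrable_of_abs_le (hFz _) fun _ => hC _).sub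
              (integrable_of_abs_le (hFz _) fun _ => hC _)) (integrable_const _) fun w => ?_
            have := hd (Fin.cons w S) i.succ z
            rwa [Fin.cons_update]
        _ = c := by simp
    have hE : ∫ T, F T ∂(Measure.pi fun _ : Fin (n + 1) => ν)
        = ∫ T, G T ∂(Measure.pi fun _ : Fin n => ν) := integral_pi_succ ν F hF hC
    rw [hE]
    set E := ∫ T, G T ∂(Measure.pi fun _ : Fin n => ν) with hEdef
    have hEC : |E| ≤ C := abs_integral_le_of_abs_le hGC
    have hexp : ∀ u, |u| ≤ C → ∀ v, |v| ≤ C →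
        |Real.exp (s * (u - v))| ≤ Real.exp (|s| * (2 * C)) := by
      intro u hu v hv
      rw [Real.abs_exp]
      refine Real.exp_le_exp.2 ((le_abs_self _).trans ?_)
      rw [abs_mul]
      refine mul_le_mul_of_nonneg_left ?_ (abs_nonneg _)
      linarith [abs_sub u v]
    rw [integral_pi_succ ν (fun S => Real.exp (s * (F S - E))) (by fun_prop)
      (fun S => hexp _ (hC S) _ hEC)]
    have hin : ∀ S : Fin n → Z, ∫ z, Real.exp (s * (F (Fin.cons z S) - E)) ∂ν ≤
        Real.exp ((c / 2) ^ 2 * s ^ 2 / 2) * Real.exp (s * (G S - E)) := by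
      intro S
      -- `F - E = (F - G) + (G - E)`: for fixed `S` the first term is centered in `z`, and the
      -- second is constant.
      have : ∀ z, Real.exp (s * (F (Fin.cons z S) - E)) =
          Real.exp (s * (F (Fin.cons z S) - G S)) * Real.exp (s * (G S - E)) := by
        intro z
        rw [← Real.exp_add]
        ring_nf
      simp only [this]
      rw [integral_mul_const]
      refine mul_le_mul_of_nonneg_right ?_ (Real.exp_pos _).le
      refine integral_exp_centered_le_of_oscillation ν (hFz S) (fun z w => ?_) s
      have := hd (Fin.cons w S) 0 z
      rwa [Fin.update_cons_zero] at this
    calc _ ≤ ∫ S, Real.exp ((c / 2) ^ 2 * s ^ 2 / 2) * Real.exp (s * (G S - E))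
            ∂(Measure.pi fun _ : Fin n => ν) := by
          refine integral_mono_of_nonneg (ae_of_all _ fun S => ?_) ?_ (ae_of_all _ hin)
          · exact integral_nonneg fun _ => (Real.exp_pos _).le
          · exact (integrable_of_abs_le (by fun_prop) fun S => hexp _ (hGC S) _ hEC).const_mul _
      _ ≤ Real.exp ((c / 2) ^ 2 * s ^ 2 / 2) * Real.exp (n * (c / 2) ^ 2 * s ^ 2 / 2) := by
          rw [integral_const_mul]
          exact mul_le_mul_of_nonneg_left
            (integral_exp_centered_le_of_bounded_differences ν s n G hGm C hGC hGd)
            (Real.exp_pos _).le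
      _ = _ := by
          rw [← Real.exp_add]
          push_cast
          ring_nf

/-- **McDiarmid's inequality** for independent, identically distributed coordinates. -/
theorem measure_real_ge_le_of_bounded_differences (ν : Measure Z) [IsProbabilityMeasure ν]
    {n : ℕ} {F : (Fin n → Z) → ℝ} (hF : Measurable F) {c C : ℝ} (hC : ∀ S, |F S| ≤ C)
    (hd : ∀ S i z, F (Function.update S i z) - F S ≤ c) {ε : ℝ} (hε : 0 ≤ ε) :
    (Measure.pi fun _ : Fin n => ν).real
        {S | ε ≤ F S - ∫ T, F T ∂(Measure.pi fun _ : Fin n => ν)} ≤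
      Real.exp (-ε ^ 2 / (2 * (n * (c / 2) ^ 2))) := by
  have hE : |∫ T, F T ∂(Measure.pi fun _ : Fin n => ν)| ≤ C := abs_integral_le_of_abs_le hC
  have h : ProbabilityTheory.HasSubgaussianMGF
      (fun S => F S - ∫ T, F T ∂(Measure.pi fun _ : Fin n => ν))
      (⟨n * (c / 2) ^ 2, by positivity⟩ : NNReal) (Measure.pi fun _ : Fin n => ν) := by
    refine ⟨fun t => ?_, fun t => ?_⟩
    · refine integrable_of_abs_le (C := Real.exp (|t| * (2 * C))) (by fun_prop) fun S => ?_
      rw [Real.abs_exp]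
      refine Real.exp_le_exp.2 ((le_abs_self _).trans ?_)
      rw [abs_mul]
      refine mul_le_mul_of_nonneg_left ?_ (abs_nonneg _)
      linarith [abs_sub (F S) (∫ T, F T ∂(Measure.pi fun _ : Fin n => ν)), hC S]
    · exact integral_exp_centered_le_of_bounded_differences ν t n F hF C hC hd
  exact h.measure_ge_le hε

end BoundedDifferences

/-! ### Rademacher sums: contraction and linear classes. -/

section Rademacher

/-- The real sign attached to a boolean. -/
def boolSign (s : Bool) : ℝ := if s then 1 else -1

@[simp] theorem boolSign_true : boolSign true = 1 := rfl

@[simp] theorem boolSign_false : boolSign false = -1 := rfl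

@[simp] theorem boolSign_not (s : Bool) : boolSign (!s) = -boolSign s := by
  cases s <;> simp

@[simp] theorem abs_boolSign (s : Bool) : |boolSign s| = 1 := by cases s <;> simp

theorem sum_bool_fun_succ {n : ℕ} (f : (Fin (n + 1) → Bool) → ℝ) :
    ∑ σ, f σ = ∑ σ : Fin n → Bool, (f (Fin.cons true σ) + f (Fin.cons false σ)) := by
  rw [← (Fin.consEquiv fun _ : Fin (n + 1) => Bool).sum_comp, Fintype.sum_prod_type,
    Fintype.sum_bool, ← Finset.sum_add_distrib]
  rfl

theorem sum_bool_fun_not {n : ℕ} (f : (Fin n → Bool) → ℝ) :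
    ∑ σ : Fin n → Bool, f (fun i => !σ i) = ∑ σ, f σ :=
  (Equiv.piCongrRight fun _ : Fin n => Equiv.boolNot).sum_comp f

variable {ι : Type*}

theorem abs_sum_boolSign_mul_le {n : ℕ} (σ : Fin n → Bool) {u : Fin n → ℝ} {K : ℝ}
    (h : ∀ i, |u i| ≤ K) : |∑ i, boolSign (σ i) * u i| ≤ n * K := by
  refine (Finset.abs_sum_le_sum_abs _ _).trans ?_
  calc _ ≤ ∑ _i : Fin n, K := Finset.sum_le_sum fun i _ => by
        rw [abs_mul, abs_boolSign, one_mul]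
        exact h i
    _ = n * K := by simp

theorem bddAbove_range_of_abs_le {f : ι → ℝ} {K : ℝ} (h : ∀ k, |f k| ≤ K) :
    BddAbove (Set.range f) :=
  ⟨K, by rintro _ ⟨k, rfl⟩; exact (le_abs_self _).trans (h k)⟩

theorem abs_ciSup_le_of_abs_le [Nonempty ι] {f : ι → ℝ} {K : ℝ} (h : ∀ k, |f k| ≤ K) :
    |⨆ k, f k| ≤ K := by
  obtain ⟨k⟩ := ‹Nonempty ι›
  have : Nonempty ι := ⟨k⟩
  exact abs_le.2 ⟨(neg_le_of_abs_le (h k)).trans (le_ciSup (bddAbove_range_of_abs_le h) k),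
    ciSup_le fun k => (le_abs_self _).trans (h k)⟩

/-- This is contraction for a single sign. The two suprema are tested at independent indices `k`,
`l`; if `v k - v l` is negative, exchanging the roles of `k` and `l` on the right restores the sign.
-/
theorem ciSup_add_ciSup_sub_le [Nonempty ι] {A u v : ι → ℝ}
    (huv : ∀ k l, |u k - u l| ≤ |v k - v l|)
    (hp : BddAbove (Set.range fun k => A k + v k))
    (hm : BddAbove (Set.range fun k => A k - v k)) :
    (⨆ k, (A k + u k)) + (⨆ k, (A k - u k)) ≤ (⨆ k, (A k + v k)) + ⨆ k, (A k - v k) := by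
  have key : ∀ k l, A k + u k + (A l - u l) ≤ (⨆ k, (A k + v k)) + ⨆ k, (A k - v k) := by
    intro k l
    have h1 := (le_abs_self _).trans (huv k l)
    rcases abs_cases (v k - v l) with ⟨h, _⟩ | ⟨h, _⟩
    · linarith [le_ciSup hp k, le_ciSup hm l]
    · linarith [le_ciSup hp l, le_ciSup hm k]
  have h1 : ∀ l, (⨆ k, (A k + u k)) ≤
      ((⨆ k, (A k + v k)) + ⨆ k, (A k - v k)) - (A l - u l) := fun l =>
    ciSup_le fun k => by linarith [key k l]
  have h2 : (⨆ l, (A l - u l)) ≤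
      ((⨆ k, (A k + v k)) + ⨆ k, (A k - v k)) - ⨆ k, (A k + u k) :=
    ciSup_le fun l => by linarith [h1 l]
  linarith

/-- The **contraction principle** for Rademacher sums: contracting the coordinates of an index
class does not increase its expected Rademacher supremum. -/
theorem sum_ciSup_boolSign_le_of_contraction [Nonempty ι] {K : ℝ} :
    ∀ (n : ℕ) (A : ι → ℝ) (K' : ℝ) (u v : ι → Fin n → ℝ), (∀ k, |A k| ≤ K') →
      (∀ k i, |u k i| ≤ K) → (∀ k i, |v k i| ≤ K) →
      (∀ k l i, |u k i - u l i| ≤ |v k i - v l i|) →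
      ∑ σ : Fin n → Bool, ⨆ k, (A k + ∑ i, boolSign (σ i) * u k i) ≤
        ∑ σ : Fin n → Bool, ⨆ k, (A k + ∑ i, boolSign (σ i) * v k i)
  | 0, A, K', u, v, hA, hu, hv, huv => by simp
  | n + 1, A, K', u, v, hA, hu, hv, huv => by
    -- The offset `A` exists to absorb the first sign: the hypothesis is used with `A ± u · 0`,
    -- whose bound grows to `K' + K`.
    have ih := fun (B : ι → ℝ) (hB : ∀ k, |B k| ≤ K' + K) =>
      sum_ciSup_boolSign_le_of_contraction n B (K' + K) (fun k i => u k i.succ)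
        (fun k i => v k i.succ) hB (fun k i => hu k _) (fun k i => hv k _) fun k l i => huv k l _
    have ih1 := ih (fun k => A k + u k 0) fun k =>
      (abs_add_le _ _).trans (add_le_add (hA k) (hu k 0))
    have ih2 := ih (fun k => A k - u k 0) fun k =>
      (abs_sub _ _).trans (add_le_add (hA k) (hu k 0))
    rw [sum_bool_fun_succ, sum_bool_fun_succ]
    simp only [Fin.sum_univ_succ, Fin.cons_zero, Fin.cons_succ, boolSign_true, boolSign_false,
      one_mul, neg_mul, ← add_assoc, ← sub_eq_add_neg]
    rw [Finset.sum_add_distrib]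
    refine (add_le_add ih1 ih2).trans ?_
    rw [← Finset.sum_add_distrib]
    refine Finset.sum_le_sum fun σ _ => ?_
    have hs : ∀ k, |∑ i : Fin n, boolSign (σ i) * v k i.succ| ≤ n * K := fun k =>
      abs_sum_boolSign_mul_le σ fun i => hv k _
    have h := ciSup_add_ciSup_sub_le
      (A := fun k => A k + ∑ i : Fin n, boolSign (σ i) * v k i.succ)
      (u := fun k => u k 0) (v := fun k => v k 0) (fun k l => huv k l 0)
      (bddAbove_range_of_abs_le (K := K' + n * K + K) fun k =>
        (abs_add_le _ _).trans (add_le_add ((abs_add_le _ _).trans (add_le_add (hA k) (hs k)))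
          (hv k 0)))
      (bddAbove_range_of_abs_le (K := K' + n * K + K) fun k =>
        (abs_sub _ _).trans (add_le_add ((abs_add_le _ _).trans (add_le_add (hA k) (hs k)))
          (hv k 0)))
    simpa only [add_right_comm, sub_add_eq_add_sub] using h

variable {E : Type*} [NormedAddCommGroup E] [InnerProductSpace ℝ E]

/-- Cross terms cancel over the signs. The offset `c` lets the induction move `± x 0` into it, and
the parallelogram law closes the step. -/
theorem sum_norm_sq_boolSign_smul : ∀ (n : ℕ) (c : E) (x : Fin n → E),
    ∑ σ : Fin n → Bool, ‖c + ∑ i, boolSign (σ i) • x i‖ ^ 2 =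
      2 ^ n * (‖c‖ ^ 2 + ∑ i, ‖x i‖ ^ 2)
  | 0, c, x => by simp
  | n + 1, c, x => by
    rw [sum_bool_fun_succ]
    simp only [Fin.sum_univ_succ, Fin.cons_zero, Fin.cons_succ, boolSign_true, boolSign_false,
      one_smul, neg_smul, ← add_assoc]
    rw [Finset.sum_add_distrib, sum_norm_sq_boolSign_smul n, sum_norm_sq_boolSign_smul n]
    have h := parallelogram_law_with_norm ℝ c (x 0)
    rw [← sub_eq_add_neg]
    linear_combination 2 ^ n * h

/-- The expected norm of a Rademacher sum of `n` vectors of norm at most `R` is at most `R √n`. -/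
theorem sum_norm_boolSign_smul_le {n : ℕ} {x : Fin n → E} {R : ℝ} (hR : 0 ≤ R)
    (hx : ∀ i, ‖x i‖ ≤ R) :
    ∑ σ : Fin n → Bool, ‖∑ i, boolSign (σ i) • x i‖ ≤ 2 ^ n * (R * √n) := by
  have h1 := sum_norm_sq_boolSign_smul n 0 x
  simp only [zero_add, norm_zero] at h1
  have h2 : ∑ i, ‖x i‖ ^ 2 ≤ n * R ^ 2 := by
    calc _ ≤ ∑ _i : Fin n, R ^ 2 :=
          Finset.sum_le_sum fun i _ => pow_le_pow_left₀ (norm_nonneg _) (hx i) 2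
      _ = _ := by simp
  -- Cauchy–Schwarz over the `2 ^ n` sign patterns: the mean norm is at most the root mean square.
  have h3 := sq_sum_le_card_mul_sum_sq (s := (Finset.univ : Finset (Fin n → Bool)))
    (f := fun σ => ‖∑ i, boolSign (σ i) • x i‖)
  refine le_of_sq_le_sq ?_ (by positivity)
  refine h3.trans ?_
  rw [h1]
  have : (2 ^ n * (R * √(n : ℝ))) ^ 2 = 2 ^ n * (2 ^ n * (n * R ^ 2)) := by
    rw [mul_pow, mul_pow, Real.sq_sqrt (Nat.cast_nonneg n)]
    ring
  rw [this]
  simp only [Finset.card_univ, Fintype.card_pi, Fintype.card_bool, Finset.prod_const,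
    Fintype.card_fin, Nat.cast_pow, Nat.cast_ofNat]
  gcongr
  simpa using h2

/-- The Rademacher complexity of a bounded class of linear functionals. -/
theorem sum_ciSup_boolSign_inner_le [Nonempty ι] {n : ℕ} {w : ι → E} {x : Fin n → E} {B R : ℝ}
    (hR : 0 ≤ R) (hw : ∀ k, ‖w k‖ ≤ B) (hx : ∀ i, ‖x i‖ ≤ R) :
    ∑ σ : Fin n → Bool, ⨆ k, ∑ i, boolSign (σ i) * ⟪w k, x i⟫ ≤ 2 ^ n * (B * R * √n) := by
  obtain ⟨k₀⟩ := ‹Nonempty ι›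
  have : Nonempty ι := ⟨k₀⟩
  have hB : 0 ≤ B := (norm_nonneg _).trans (hw k₀)
  calc _ ≤ ∑ σ : Fin n → Bool, B * ‖∑ i, boolSign (σ i) • x i‖ := by
        refine Finset.sum_le_sum fun σ _ => ciSup_le fun k => ?_
        have : ∑ i, boolSign (σ i) * ⟪w k, x i⟫ = ⟪w k, ∑ i, boolSign (σ i) • x i⟫ := by
          simp [inner_sum, inner_smul_right]
        rw [this]
        exact (real_inner_le_norm _ _).trans (mul_le_mul_of_nonneg_right (hw k) (norm_nonneg _))
    _ ≤ B * (2 ^ n * (R * √n)) := by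
        rw [← Finset.mul_sum]
        exact mul_le_mul_of_nonneg_left (sum_norm_boolSign_smul_le hR hx) hB
    _ = _ := by ring

end Rademacher

/-! ### Symmetrization and uniform deviation for countable classes. -/

section UniformDeviation

variable {Z : Type*} [MeasurableSpace Z] {n : ℕ}

/-- Exchanging some coordinates of an i.i.d. sample with those of its ghost sample preserves the
joint law. -/
theorem measurePreserving_swap_of_sign (ν : Measure Z) [IsProbabilityMeasure ν]
    (σ : Fin n → Bool) :
    MeasurePreserving (fun (p : Fin n → Z × Z) i => if σ i then p i else (p i).swap)
      (Measure.pi fun _ => ν.prod ν) (Measure.pi fun _ => ν.prod ν) := by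
  refine measurePreserving_pi (fun _ => ν.prod ν) (fun _ => ν.prod ν)
    (f := fun i (p : Z × Z) => if σ i then p else p.swap) fun i => ?_
  cases h : σ i
  · simpa using Measure.measurePreserving_swap (μ := ν) (ν := ν)
  · simpa [Function.id_def] using MeasurePreserving.id (ν.prod ν)

/-- **Symmetrization**: a bound on the empirical Rademacher complexity of a countable class that
holds for almost every sample bounds the expected uniform deviation. -/
theorem integral_ciSup_le_of_rademacher (ν : Measure Z) [IsProbabilityMeasure ν]
    {g : ℕ → Z → ℝ} (hg : ∀ k, Measurable (g k)) {C : ℝ} (hC : ∀ k z, |g k z| ≤ C) {r : ℝ}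
    (hr : ∀ᵐ S ∂(Measure.pi fun _ : Fin n => ν),
      ∑ σ : Fin n → Bool, ⨆ k, ∑ i, boolSign (σ i) * g k (S i) ≤ 2 ^ n * r) :
    ∫ S, ⨆ k, ∑ i, (∫ z, g k z ∂ν - g k (S i)) ∂(Measure.pi fun _ : Fin n => ν) ≤ 2 * r := by
  set P := Measure.pi fun _ : Fin n => ν with hP
  set PP := Measure.pi fun _ : Fin n => ν.prod ν with hPP
  have hsub : ∀ k z w, |g k z - g k w| ≤ 2 * C := fun k z w => by
    linarith [abs_sub (g k z) (g k w), hC k z, hC k w]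
  have hsum : ∀ (u : ℕ → Fin n → ℝ), (∀ k i, |u k i| ≤ 2 * C) → ∀ k, |∑ i, u k i| ≤ n * (2 * C) :=
    fun u hu k => by
      simpa using abs_sum_boolSign_mul_le (fun _ => true) (hu k)
  set D : (Fin n → Z) → (Fin n → Z) → ℝ := fun S S' => ⨆ k, ∑ i, (g k (S' i) - g k (S i)) with hD
  have hDm : Measurable fun p : (Fin n → Z) × (Fin n → Z) => D p.1 p.2 :=
    Measurable.iSup fun k => by
      have := hg k
      fun_prop
  have hDb : ∀ S S', |D S S'| ≤ n * (2 * C) := fun S S' =>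
    abs_ciSup_le_of_abs_le (hsum _ fun k i => hsub k _ _)
  have hDi : ∀ S, Integrable (D S) P := fun S =>
    integrable_of_abs_le (hDm.comp (measurable_const.prodMk measurable_id)) (hDb S)
  have hEC : ∀ k, |∫ z, g k z ∂ν| ≤ C := fun k => abs_integral_le_of_abs_le (hC k)
  -- The expectation of each `g k` is replaced by an average over a ghost sample `S'`; a supremum of
  -- integrals is at most the integral of the supremum.
  have step1 : ∀ S, ⨆ k, ∑ i, (∫ z, g k z ∂ν - g k (S i)) ≤ ∫ S', D S S' ∂P := by
    intro S
    refine ciSup_le fun k => ?_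
    have hi : ∀ i, Integrable (fun S' : Fin n → Z => g k (S' i)) P := fun i =>
      integrable_of_abs_le ((hg k).comp (measurable_pi_apply i)) fun S' => hC k _
    have hd : ∀ i ∈ Finset.univ, Integrable (fun S' : Fin n → Z => g k (S' i) - g k (S i)) P :=
      fun i _ => (hi i).sub (integrable_const _)
    have : ∑ i, (∫ z, g k z ∂ν - g k (S i)) = ∫ S', ∑ i, (g k (S' i) - g k (S i)) ∂P := by
      rw [integral_finsetSum _ hd]
      refine Finset.sum_congr rfl fun i _ => ?_
      rw [integral_sub (hi i) (integrable_const _),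
        integral_comp_eval (μ := fun _ : Fin n => ν) (hg k).aestronglyMeasurable]
      simp
    rw [this]
    refine integral_mono (integrable_finsetSum _ hd) (hDi S) fun S' => ?_
    exact le_ciSup (bddAbove_range_of_abs_le
      (hsum (fun k i => g k (S' i) - g k (S i)) fun k i => hsub k _ _)) k
  have step2 : ∫ S, ∫ S', D S S' ∂P ∂P =
      ∫ p, ⨆ k, ∑ i, (g k (p i).2 - g k (p i).1) ∂PP := by
    rw [← integral_prod (f := fun p : (Fin n → Z) × (Fin n → Z) => D p.1 p.2)
      (integrable_of_abs_le hDm fun p => hDb _ _)]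
    have h := measurePreserving_arrowProdEquivProdArrow Z Z (Fin n) (fun _ => ν) (fun _ => ν)
    exact (h.integral_comp' (fun p : (Fin n → Z) × (Fin n → Z) => D p.1 p.2)).symm
  have hTm : ∀ σ : Fin n → Bool, Measurable fun p : Fin n → Z × Z =>
      ⨆ k, ∑ i, boolSign (σ i) * (g k (p i).2 - g k (p i).1) := fun σ =>
    Measurable.iSup fun k => by
      have := hg k
      fun_prop
  have hTi : ∀ σ : Fin n → Bool, Integrable (fun p : Fin n → Z × Z =>
      ⨆ k, ∑ i, boolSign (σ i) * (g k (p i).2 - g k (p i).1)) PP := fun σ =>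
    integrable_of_abs_le (C := n * (2 * C)) (hTm σ) fun p => abs_ciSup_le_of_abs_le fun k =>
      abs_sum_boolSign_mul_le σ fun i => hsub k _ _
  -- A negative sign at `i` amounts to swapping the `i`-th sample point with its ghost.
  have step3 : ∀ σ : Fin n → Bool, ∫ p, ⨆ k, ∑ i, (g k (p i).2 - g k (p i).1) ∂PP =
      ∫ p, ⨆ k, ∑ i, boolSign (σ i) * (g k (p i).2 - g k (p i).1) ∂PP := by
    intro σ
    have h := measurePreserving_swap_of_sign ν σ
    have hm := hTm fun _ => true
    simp only [boolSign_true, one_mul] at hm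
    have h2 := integral_map (μ := PP) h.measurable.aemeasurable
      (f := fun p => ⨆ k, ∑ i, (g k (p i).2 - g k (p i).1)) hm.aestronglyMeasurable
    rw [h.map_eq] at h2
    rw [h2]
    congr 1
    funext p
    congr 1
    funext k
    refine Finset.sum_congr rfl fun i _ => ?_
    cases hs : σ i <;> simp [hs]
  have hr1 : ∀ᵐ p ∂PP, ∑ σ : Fin n → Bool, ⨆ k, ∑ i, boolSign (σ i) * g k (p i).1 ≤ 2 ^ n * r :=
    (measurePreserving_pi (fun _ : Fin n => ν.prod ν) (fun _ => ν)
      (f := fun _ => Prod.fst) fun _ => measurePreserving_fst).quasiMeasurePreserving.ae hr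
  have hr2 : ∀ᵐ p ∂PP, ∑ σ : Fin n → Bool, ⨆ k, ∑ i, boolSign (σ i) * g k (p i).2 ≤ 2 ^ n * r :=
    (measurePreserving_pi (fun _ : Fin n => ν.prod ν) (fun _ => ν)
      (f := fun _ => Prod.snd) fun _ => measurePreserving_snd).quasiMeasurePreserving.ae hr
  have step4 : ∀ᵐ p ∂PP, ∑ σ : Fin n → Bool,
      ⨆ k, ∑ i, boolSign (σ i) * (g k (p i).2 - g k (p i).1) ≤ 2 ^ n * (2 * r) := by
    filter_upwards [hr1, hr2] with p h1 h2
    -- Flipping all signs permutes the patterns, so the minus sign before the first sample is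
    -- harmless.
    have h3 := sum_bool_fun_not fun σ : Fin n → Bool =>
      ⨆ k, ∑ i, boolSign (σ i) * g k (p i).1
    rw [← h3] at h1
    have hb : ∀ (σ : Fin n → Bool) (z : Fin n → Z),
        BddAbove (Set.range fun k => ∑ i, boolSign (σ i) * g k (z i)) := fun σ z =>
      bddAbove_range_of_abs_le fun k => abs_sum_boolSign_mul_le σ fun i => hC k (z i)
    calc _ ≤ ∑ σ : Fin n → Bool, ((⨆ k, ∑ i, boolSign (σ i) * g k (p i).2) +
          ⨆ k, ∑ i, boolSign (!σ i) * g k (p i).1) := by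
          refine Finset.sum_le_sum fun σ _ => ciSup_le fun k => ?_
          have ha := le_ciSup (hb σ fun i => (p i).2) k
          have hb' := le_ciSup (hb (fun i => !σ i) fun i => (p i).1) k
          refine le_trans (le_of_eq ?_) (add_le_add ha hb')
          rw [← Finset.sum_add_distrib]
          refine Finset.sum_congr rfl fun i _ => ?_
          rw [boolSign_not]
          ring
      _ ≤ 2 ^ n * r + 2 ^ n * r := by
          rw [Finset.sum_add_distrib]
          exact add_le_add h2 h1
      _ = _ := by ring
  have hΦm : Measurable fun S : Fin n → Z => ⨆ k, ∑ i, (∫ z, g k z ∂ν - g k (S i)) :=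
    Measurable.iSup fun k => by
      have := hg k
      fun_prop
  have hΦi : Integrable (fun S : Fin n → Z => ⨆ k, ∑ i, (∫ z, g k z ∂ν - g k (S i))) P :=
    integrable_of_abs_le (C := n * (2 * C)) hΦm fun S =>
      abs_ciSup_le_of_abs_le (hsum _ fun k i => by
        linarith [abs_sub (∫ z, g k z ∂ν) (g k (S i)), hC k (S i), hEC k])
  have h5 : ∫ p, ⨆ k, ∑ i, (g k (p i).2 - g k (p i).1) ∂PP ≤ 2 * r := by
    have h6 : (2 : ℝ) ^ n * ∫ p, ⨆ k, ∑ i, (g k (p i).2 - g k (p i).1) ∂PP =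
        ∫ p, ∑ σ : Fin n → Bool,
          ⨆ k, ∑ i, boolSign (σ i) * (g k (p i).2 - g k (p i).1) ∂PP := by
      rw [integral_finsetSum _ fun σ _ => hTi σ,
        ← Finset.sum_congr rfl fun σ _ => step3 σ]
      simp
    have h7 := integral_mono_ae (integrable_finsetSum _ fun σ _ => hTi σ)
      (integrable_const _) step4
    rw [← h6] at h7
    simp only [integral_const, probReal_univ, one_smul] at h7
    exact le_of_mul_le_mul_left h7 (by positivity)
  refine le_trans (integral_mono hΦi ?_ step1) (step2.trans_le h5)
  exact (integrable_of_abs_le (ν := P.prod P) hDm fun p => hDb _ _).integral_prod_left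

/-- A uniform deviation bound for a countable class of functions with values in `[0, C]`, in terms
of a bound on the empirical Rademacher complexity. -/
theorem ofReal_one_sub_le_measure_uniform_deviation (hn : 0 < n) (ν : Measure Z)
    [IsProbabilityMeasure ν] {g : ℕ → Z → ℝ} (hg : ∀ k, Measurable (g k)) {C : ℝ} (hC0 : 0 < C)
    (hC : ∀ k z, g k z ∈ Set.Icc 0 C) {r : ℝ}
    (hr : ∀ᵐ S ∂(Measure.pi fun _ : Fin n => ν),
      ∑ σ : Fin n → Bool, ⨆ k, ∑ i, boolSign (σ i) * g k (S i) ≤ 2 ^ n * (n * r))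
    {δ : ℝ} (hδ : 0 < δ) (hδ1 : δ ≤ 1) :
    ENNReal.ofReal (1 - δ) ≤ (Measure.pi fun _ : Fin n => ν)
      {S | ∀ k, ∫ z, g k z ∂ν ≤ (1 / (n : ℝ)) * ∑ i, g k (S i) + 2 * r
        + C * √(Real.log (1 / δ) / (2 * (n : ℝ)))} := by
  set P := Measure.pi fun _ : Fin n => ν with hP
  have hn' : (0 : ℝ) < n := by exact_mod_cast hn
  have habs : ∀ k z, |g k z| ≤ C := fun k z => abs_le.2 ⟨by linarith [(hC k z).1], (hC k z).2⟩
  have hEC : ∀ k, |∫ z, g k z ∂ν| ≤ C := fun k => abs_integral_le_of_abs_le (habs k)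
  set Φ : (Fin n → Z) → ℝ := fun S => ⨆ k, ∑ i, (∫ z, g k z ∂ν - g k (S i)) with hΦ
  have hΦm : Measurable Φ := Measurable.iSup fun k => by
    have := hg k
    fun_prop
  have hb : ∀ (S : Fin n → Z) k, |∑ i, (∫ z, g k z ∂ν - g k (S i))| ≤ n * (2 * C) := fun S k => by
    have := abs_sum_boolSign_mul_le (K := 2 * C) (fun _ => true)
      (u := fun i => ∫ z, g k z ∂ν - g k (S i)) fun i => by
        linarith [abs_sub (∫ z, g k z ∂ν) (g k (S i)), habs k (S i), hEC k]
    simpa using this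
  have hΦb : ∀ S, |Φ S| ≤ n * (2 * C) := fun S => abs_ciSup_le_of_abs_le (hb S)
  have hΦk : ∀ S k, ∑ i, (∫ z, g k z ∂ν - g k (S i)) ≤ Φ S := fun S k =>
    le_ciSup (bddAbove_range_of_abs_le (hb S)) k
  -- `Φ` is not divided by `n`, so one coordinate moves it by at most `C`, the width of the range of
  -- the `g k`.
  have hd : ∀ S i z, Φ (Function.update S i z) - Φ S ≤ C := by
    intro S i z
    rw [sub_le_iff_le_add']
    refine ciSup_le fun k => ?_
    have h1 := hΦk S k
    have h2 : ∑ j, (∫ z, g k z ∂ν - g k (Function.update S i z j)) =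
        ∑ j, (∫ z, g k z ∂ν - g k (S j)) + (g k (S i) - g k z) := by
      rw [← sub_eq_iff_eq_add', ← Finset.sum_sub_distrib, Finset.sum_eq_single i]
      · simp
      · intro j _ hj
        simp [Function.update_of_ne hj]
      · simp
    rw [h2]
    linarith [(hC k (S i)).2, (hC k z).1]
  have hE : ∫ S, Φ S ∂P ≤ 2 * (n * r) := integral_ciSup_le_of_rademacher ν hg habs hr
  have hlog : 0 ≤ Real.log (1 / δ) := Real.log_nonneg (by rw [le_div_iff₀ hδ]; linarith)
  -- Chosen so that McDiarmid's tail `exp(-2ε²/(nC²))` equals `δ`.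
  set ε := n * (C * √(Real.log (1 / δ) / (2 * (n : ℝ)))) with hε
  have hε0 : 0 ≤ ε := by positivity
  have htail := measure_real_ge_le_of_bounded_differences ν hΦm hΦb hd hε0
  have hexp : Real.exp (-ε ^ 2 / (2 * (n * (C / 2) ^ 2))) = δ := by
    have : -ε ^ 2 / (2 * (n * (C / 2) ^ 2)) = Real.log δ := by
      rw [hε, mul_pow, mul_pow, Real.sq_sqrt (by positivity), one_div, Real.log_inv]
      field_simp
    rw [this, Real.exp_log hδ]
  rw [hexp] at htail
  set T := {S | ε ≤ Φ S - ∫ T, Φ T ∂P} with hT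
  have hTm : MeasurableSet T := measurableSet_le measurable_const (hΦm.sub_const _)
  have hc : Tᶜ ⊆ {S | ∀ k, ∫ z, g k z ∂ν ≤ (1 / (n : ℝ)) * ∑ i, g k (S i) + 2 * r
        + C * √(Real.log (1 / δ) / (2 * (n : ℝ)))} := by
    intro S hS k
    simp only [hT, Set.mem_compl_iff, Set.mem_ofPred_eq, not_le] at hS
    have h1 := hΦk S k
    rw [Finset.sum_sub_distrib] at h1
    simp only [Finset.sum_const, Finset.card_univ, Fintype.card_fin, nsmul_eq_mul] at h1
    have h2 : n * ∫ z, g k z ∂ν ≤ ∑ i, g k (S i) + n * (2 * r) + ε := by linarith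
    refine le_of_mul_le_mul_left (h2.trans (le_of_eq ?_)) hn'
    rw [hε]
    field_simp
  refine le_trans ?_ (measure_mono hc)
  rw [← ofReal_measureReal]
  refine ENNReal.ofReal_le_ofReal ?_
  rw [probReal_compl_eq_one_sub hTm]
  linarith

end UniformDeviation

/-! ### The truncated power loss and its Lipschitz constant. -/

section TruncatedLoss

/-- The `q`-th power loss of a residual, truncated at the level `M`. -/
noncomputable def truncatedPow (q M t : ℝ) : ℝ := (min |t| M) ^ q

theorem truncatedPow_of_abs_le {q M t : ℝ} (h : |t| ≤ M) : truncatedPow q M t = |t| ^ q := by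
  rw [truncatedPow, min_eq_left h]

theorem truncatedPow_mem_Icc {q M : ℝ} (hq : 1 ≤ q) (hM : 0 < M) (t : ℝ) :
    truncatedPow q M t ∈ Set.Icc 0 (M ^ q) := by
  have h0 : 0 ≤ min |t| M := le_min (abs_nonneg _) hM.le
  exact ⟨Real.rpow_nonneg h0 _, Real.rpow_le_rpow h0 (min_le_right _ _) (by linarith)⟩

/-- Mean value inequality: the derivative `q t^(q-1)` is largest at `t = M` because `q ≥ 1`. -/
theorem abs_rpow_sub_rpow_le {q M x y : ℝ} (hq : 1 ≤ q) (hx : x ∈ Set.Icc 0 M)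
    (hy : y ∈ Set.Icc 0 M) : |x ^ q - y ^ q| ≤ q * M ^ (q - 1) * |x - y| := by
  refine (convex_Icc 0 M).norm_image_sub_le_of_norm_hasDerivWithin_le (f := fun t => t ^ q)
    (f' := fun t => q * t ^ (q - 1))
    (fun t _ => (Real.hasDerivAt_rpow_const (Or.inr hq)).hasDerivWithinAt) (fun t ht => ?_) hy hx
  rw [Real.norm_eq_abs, abs_of_nonneg (mul_nonneg (by linarith) (Real.rpow_nonneg ht.1 _))]
  exact mul_le_mul_of_nonneg_left (Real.rpow_le_rpow ht.1 ht.2 (by linarith)) (by linarith)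

theorem abs_truncatedPow_sub_le {q M : ℝ} (hq : 1 ≤ q) (hM : 0 < M) (s t : ℝ) :
    |truncatedPow q M s - truncatedPow q M t| ≤ q * M ^ (q - 1) * |s - t| := by
  have hmem : ∀ u : ℝ, min |u| M ∈ Set.Icc 0 M := fun u =>
    ⟨le_min (abs_nonneg _) hM.le, min_le_right _ _⟩
  refine (abs_rpow_sub_rpow_le hq (hmem s) (hmem t)).trans ?_
  refine mul_le_mul_of_nonneg_left ?_ (mul_nonneg (by linarith) (Real.rpow_nonneg hM.le _))
  refine (abs_min_sub_min_le_max _ _ _ _).trans ?_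
  rw [sub_self, abs_zero, max_eq_left (abs_nonneg _)]
  exact abs_abs_sub_abs_le_abs_sub _ _

theorem continuous_truncatedPow {q M : ℝ} (hq : 1 ≤ q) : Continuous (truncatedPow q M) :=
  (continuous_abs.min continuous_const).rpow_const fun _ => Or.inr (by linarith)

end TruncatedLoss

/-! ### Balls of linear predictors. -/

section LinearClass

theorem norm_liftedInput {d b m : ℕ}
    (ψ : EuclideanSpace ℝ (Fin d) → EuclideanSpace ℝ (Fin b))
    (a : EuclideanSpace ℝ (Fin m)) (x : EuclideanSpace ℝ (Fin d)) :
    ‖liftedInput ψ a x‖ = ‖ψ x‖ * ‖a‖ := by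
  rw [EuclideanSpace.norm_eq, EuclideanSpace.norm_eq, EuclideanSpace.norm_eq,
    ← Real.sqrt_mul (Finset.sum_nonneg fun _ _ => by positivity), Fintype.sum_prod_type]
  congr 1
  rw [mul_comm, Finset.sum_mul_sum]
  refine Finset.sum_congr rfl fun i _ => Finset.sum_congr rfl fun j _ => ?_
  simp only [liftedInput, Matrix.vec, Matrix.vecMulVec_apply, norm_mul]
  ring

theorem measurable_liftedInput {d b m : ℕ}
    {ψ : EuclideanSpace ℝ (Fin d) → EuclideanSpace ℝ (Fin b)} (hψ : Measurable ψ)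
    (a : EuclideanSpace ℝ (Fin m)) : Measurable (liftedInput ψ a) := by
  refine (WithLp.measurable_toLp 2 _).comp (measurable_pi_iff.2 fun p => ?_)
  simp only [Matrix.vec, Matrix.vecMulVec_apply]
  fun_prop

theorem weightVec_surjective {b m : ℕ} : Function.Surjective (weightVec (b := b) (m := m)) :=
  fun w => ⟨Matrix.of fun i j => w (i, j), rfl⟩

theorem inner_mem_lamClass {b m : ℕ} {Bw : ℝ} {w : EuclideanSpace ℝ (Fin m × Fin b)}
    (hw : ‖w‖ ≤ Bw) : (fun z => ⟪w, z⟫) ∈ lamClass m b Bw := by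
  obtain ⟨W, rfl⟩ := weightVec_surjective w
  exact ⟨W, hw, fun _ => rfl⟩

variable {E : Type*} [NormedAddCommGroup E] [InnerProductSpace ℝ E] [MeasurableSpace E]
  [BorelSpace E] [SecondCountableTopology E]

/-- A uniform deviation bound for the truncated power loss over a ball of linear predictors. -/
theorem ofReal_one_sub_le_measure_truncatedPow {n : ℕ} (hn : 0 < n) (Q : Measure E)
    [IsProbabilityMeasure Q] {f : E → ℝ} (hf : Measurable f) {q M B R : ℝ} (hq : 1 ≤ q)
    (hM : 0 < M) (hB : 0 < B) (hR0 : 0 ≤ R) (hR : ∀ᵐ z ∂Q, ‖z‖ ≤ R) {δ : ℝ} (hδ : 0 < δ)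
    (hδ1 : δ ≤ 1) :
    ENNReal.ofReal (1 - δ) ≤ (Measure.pi fun _ : Fin n => Q)
      {S | ∀ w : E, ‖w‖ ≤ B → ∫ z, truncatedPow q M (⟪w, z⟫ - f z) ∂Q ≤
        (1 / (n : ℝ)) * ∑ i, truncatedPow q M (⟪w, S i⟫ - f (S i))
          + 2 * (q * M ^ (q - 1) * (B * R) / √(n : ℝ))
          + M ^ q * √(Real.log (1 / δ) / (2 * (n : ℝ)))} := by
  have hn' : (0 : ℝ) < n := by exact_mod_cast hn
  have hcont := continuous_truncatedPow (M := M) hq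
  have hIcc := truncatedPow_mem_Icc hq hM
  set L := q * M ^ (q - 1) with hL
  have hL0 : 0 ≤ L := mul_nonneg (by linarith) (Real.rpow_nonneg hM.le _)
  have hne : Nonempty (Metric.closedBall (0 : E) B) := ⟨⟨0, by simp [hB.le]⟩⟩
  set w : ℕ → Metric.closedBall (0 : E) B := TopologicalSpace.denseSeq _ with hw
  have hwB : ∀ k, ‖(w k : E)‖ ≤ B := fun k => mem_closedBall_zero_iff.1 (w k).2
  set g : E → E → ℝ := fun v z => truncatedPow q M (⟪v, z⟫ - f z) with hg
  have hgm : ∀ v, Measurable (g v) := fun v => hcont.measurable.comp (by fun_prop)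
  have hgc : ∀ z, Continuous fun v => g v z := fun z => hcont.comp (by fun_prop)
  have hgb : ∀ v z, |g v z| ≤ M ^ q := fun v z => by
    rw [abs_of_nonneg (hIcc _).1]
    exact (hIcc _).2
  have hr : ∀ᵐ S ∂(Measure.pi fun _ : Fin n => Q),
      ∑ σ : Fin n → Bool, ⨆ k, ∑ i, boolSign (σ i) * g (w k) (S i) ≤
        2 ^ n * (n * (L * (B * R) / √(n : ℝ))) := by
    have hS : ∀ᵐ S ∂(Measure.pi fun _ : Fin n => Q), ∀ i, ‖S i‖ ≤ R :=
      Filter.eventually_all.2 fun i =>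
        (Measure.quasiMeasurePreserving_eval (fun _ : Fin n => Q) i).ae hR
    filter_upwards [hS] with S hS
    have hM0 : 0 ≤ M ^ q := Real.rpow_nonneg hM.le _
    have hLw : ∀ k, ‖L • (w k : E)‖ ≤ L * B := fun k => by
      rw [norm_smul, Real.norm_eq_abs, abs_of_nonneg hL0]
      exact mul_le_mul_of_nonneg_left (hwB k) hL0
    have hv : ∀ k i, |⟪L • (w k : E), S i⟫| ≤ L * B * R := fun k i =>
      (abs_real_inner_le_norm _ _).trans
        (mul_le_mul (hLw k) (hS i) (norm_nonneg _) (by positivity))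
    -- The Lipschitz constant `L` is moved into the weights, so the comparison is a true
    -- contraction; labels cancel in differences at a common point. `K` merely bounds both families.
    have h1 := sum_ciSup_boolSign_le_of_contraction (K := M ^ q + L * B * R) n (fun _ : ℕ => 0) 0
      (fun k i => g (w k) (S i)) (fun k i => ⟪L • (w k : E), S i⟫) (by simp)
      (fun k i => (hgb _ _).trans (le_add_of_nonneg_right (by positivity)))
      (fun k i => (hv k i).trans (le_add_of_nonneg_left hM0)) fun k l i => by
        refine (abs_truncatedPow_sub_le hq hM _ _).trans (le_of_eq ?_)
        rw [sub_sub_sub_cancel_right, real_inner_smul_left, real_inner_smul_left, ← mul_sub,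
          abs_mul, abs_of_nonneg hL0]
    simp only [zero_add] at h1
    refine h1.trans ((sum_ciSup_boolSign_inner_le hR0 hLw hS).trans (le_of_eq ?_))
    have hsq : √(n : ℝ) * √(n : ℝ) = n := Real.mul_self_sqrt hn'.le
    have hs0 : √(n : ℝ) ≠ 0 := (Real.sqrt_pos.2 hn').ne'
    field_simp
    rw [pow_two, hsq]
  refine (ofReal_one_sub_le_measure_uniform_deviation hn Q (fun k => hgm (w k))
    (Real.rpow_pos_of_pos hM q) (fun k z => hIcc _) hr hδ hδ1).trans (measure_mono ?_)
  intro S hS v hv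
  -- Both sides are continuous in the weight (dominated convergence for the integral), so the
  -- inequality passes from the dense sequence to the ball.
  have hclosed : IsClosed {u : Metric.closedBall (0 : E) B | ∫ z, g u z ∂Q ≤
      (1 / (n : ℝ)) * ∑ i, g u (S i) + 2 * (L * (B * R) / √(n : ℝ))
        + M ^ q * √(Real.log (1 / δ) / (2 * (n : ℝ)))} := by
    refine isClosed_le ?_ ?_
    · refine continuous_of_dominated (fun u => (hgm u).aestronglyMeasurable)
        (fun u => ae_of_all _ (hgb u)) (integrable_const _)
        (ae_of_all _ fun z => (hgc z).comp continuous_subtype_val)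
    · have : ∀ i, Continuous fun u : Metric.closedBall (0 : E) B => g u (S i) := fun i =>
        (hgc _).comp continuous_subtype_val
      fun_prop
  have hall := fun u : Metric.closedBall (0 : E) B =>
    (TopologicalSpace.denseRange_denseSeq (Metric.closedBall (0 : E) B)).induction_on
      (p := fun u => ∫ z, g u z ∂Q ≤ (1 / (n : ℝ)) * ∑ i, g u (S i)
        + 2 * (L * (B * R) / √(n : ℝ)) + M ^ q * √(Real.log (1 / δ) / (2 * (n : ℝ))))
      u hclosed hS
  exact hall ⟨v, mem_closedBall_zero_iff.2 hv⟩

end LinearClass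

/-! ### The generalization bound. -/

theorem mainTheorem4 {d b m n : ℕ} (hn : 0 < n)
    (μ : Measure (EuclideanSpace ℝ (Fin d))) [IsProbabilityMeasure μ]
    (ψ : EuclideanSpace ℝ (Fin d) → EuclideanSpace ℝ (Fin b)) (hψ : Measurable ψ)
    (fQ : EuclideanSpace ℝ (Fin m × Fin b) → ℝ) (hfQ : Measurable fQ)
    (a : EuclideanSpace ℝ (Fin m))
    (q M Bw Bx Ba : ℝ) (hq : 1 ≤ q) (hM : 0 < M) (hBw : 0 < Bw)
    (hx : ∀ᵐ x ∂μ, ‖ψ x‖ ≤ Bx) (ha : ‖a‖ ≤ Ba)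
    (hbound : ∀ᵐ z ∂(sourceLaw μ ψ a), ∀ h ∈ lamClass m b Bw, |h z - fQ z| ≤ M)
    (δ : ℝ) (hδ : 0 < δ) :
    ENNReal.ofReal (1 - δ) ≤
      (Measure.pi fun _ : Fin n => sourceLaw μ ψ a)
        {S | ∀ h ∈ lamClass m b Bw,
          expectedRisk (lqLoss q) (sourceLaw μ ψ a) fQ h ≤
            empiricalRisk (lqLoss q) S fQ h
              + 2 * q * M ^ (q - 1) * (Bw * Bx * Ba) / √(n : ℝ)
              + M ^ q * √(Real.log (1 / δ) / (2 * (n : ℝ)))} := by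

  rcases lt_or_ge 1 δ with hδ1 | hδ1
  · rw [ENNReal.ofReal_of_nonpos (by linarith)]
    exact zero_le
  have hlm := measurable_liftedInput hψ a
  set Q := sourceLaw μ ψ a with hQ
  have : IsProbabilityMeasure Q := Measure.isProbabilityMeasure_map hlm.aemeasurable
  have hBx : 0 ≤ Bx := by
    obtain ⟨x, hx⟩ := hx.exists
    exact (norm_nonneg _).trans hx
  have hBa : 0 ≤ Ba := (norm_nonneg _).trans ha
  have hR : ∀ᵐ z ∂Q, ‖z‖ ≤ Bx * Ba := by
    rw [hQ, sourceLaw, ae_map_iff hlm.aemeasurable (measurableSet_le measurable_norm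
      measurable_const)]
    filter_upwards [hx] with x hx
    rw [norm_liftedInput]
    exact mul_le_mul hx ha (norm_nonneg _) hBx
  refine (ofReal_one_sub_le_measure_truncatedPow hn Q hfQ hq hM hBw (mul_nonneg hBx hBa) hR hδ
    hδ1).trans (measure_mono_ae ?_)
  -- Almost every sample has all its points where the residual bound holds, so truncation alters
  -- neither risk.
  have hS : ∀ᵐ S ∂(Measure.pi fun _ : Fin n => Q), ∀ i, ∀ h ∈ lamClass m b Bw,
      |h (S i) - fQ (S i)| ≤ M :=
    Filter.eventually_all.2 fun i =>
      (Measure.quasiMeasurePreserving_eval (fun _ : Fin n => Q) i).ae hbound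
  filter_upwards [hS] with S hS hdev h hh
  obtain ⟨W, hW, hhW⟩ := hh
  obtain rfl : h = fun z => ⟪weightVec W, z⟫ := funext hhW
  have hmem := inner_mem_lamClass hW
  have h1 : expectedRisk (lqLoss q) Q fQ (fun z => ⟪weightVec W, z⟫) =
      ∫ z, truncatedPow q M (⟪weightVec W, z⟫ - fQ z) ∂Q := by
    refine integral_congr_ae ?_
    filter_upwards [hbound] with z hz
    exact (truncatedPow_of_abs_le (hz _ hmem)).symm
  have h2 : empiricalRisk (lqLoss q) S fQ (fun z => ⟪weightVec W, z⟫) =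
      (1 / (n : ℝ)) * ∑ i, truncatedPow q M (⟪weightVec W, S i⟫ - fQ (S i)) := by
    rw [empiricalRisk]
    congr 1
    exact Finset.sum_congr rfl fun i _ => (truncatedPow_of_abs_le (hS i _ hmem)).symm
  rw [h1, h2]
  refine (hdev _ hW).trans (le_of_eq ?_)
  ring
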